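/- Let $d$ be the Euclidean distance on $\mathbb{R}^2$. For a multiset $P$ of $n\ge 1$ points of $\mathbb{R}^2$ (the preferred locations of $n$ agents) and a facility location $z\in\mathbb{R}^2$, let $C^u(z,P)=\frac1n\sum_{p\in P}d(z,p)$ be the utilitarian social cost, and call $o\in\mathbb{R}^2$ optimal for $P$ if it minimizes $C^u(\cdot,P)$. The coordinatewise median of a nonempty finite multiset of points is the point whose $x$-coordinate (respectively $y$-coordinate) is the median of the $x$-coordinates (respectively $y$-coordinates) of the points; if their number is even, the smaller of the two medians is taken. Let $c\in[0,1)$. The Coordinatewise Median with Predictions mechanism with confidence $c$ takes as input a multiset $P$ of $n \geq 1$ points, where $n$ is such that $cn$ is an integer, and a prediction $\hat o\in\mathbb{R}^2$, and outputs the coordinatewise median $f(P,\hat o,c)$ of the multiset consisting of the points of $P$ together with $cn$ copies of $\hat o$. Then the mechanism is $\frac{\sqrt{2c^2+2}}{1+c}$-consistent and $\frac{\sqrt{2c^2+2}}{1-c}$-robust for the utilitarian objective. That is, for every $n\ge1$ such that $cn$ is an integer, every multiset $P$ of $n$ points of $\mathbb{R}^2$ and every optimal location $o$ for $P$: 1.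 (consistency, i.e. the prediction is correct) $C^u(f(P,o,c),P)\le\frac{\sqrt{2c^2+2}}{1+c}\,C^u(o,P)$; 2. (robustness) $C^u(f(P,\hat o,c),P)\le\frac{\sqrt{2c^2+2}}{1-c}\,C^u(o,P)$ for every prediction $\hat o\in\mathbb{R}^2$. -/

import Mathlib

/-- The Euclidean plane; `dist` is the Euclidean distance. -/
abbrev Plane : Type := EuclideanSpace ℝ (Fin 2)

/-- The utilitarian social cost of the facility location `f` for the multiset `P` of preferred
locations of the agents: the average distance `(1 / n) ∑_{p ∈ P} d(f, p)`, where `n = |P|`. -/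
noncomputable def utilitarianCost (f : Plane) (P : Multiset Plane) : ℝ :=
  (P.map fun p => dist f p).sum / (P.card : ℝ)

/-- The point `o` is an optimal facility location for `P` with respect to the social cost `C`. -/
def IsOptimalLocation (C : Plane → Multiset Plane → ℝ) (o : Plane) (P : Multiset Plane) : Prop :=
  ∀ z : Plane, C o P ≤ C z P

/-- The median of a nonempty finite multiset of reals, the smaller of the two medians if the
number of elements is even: for `m` elements `a₀ ≤ a₁ ≤ … ≤ a_{m-1}` this is
`a_{⌊(m-1)/2⌋}`. (The value for the empty multiset is irrelevant.) -/
noncomputable def lowerMedian (s : Multiset ℝ) : ℝ :=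
  (s.sort (· ≤ ·)).getD ((s.card - 1) / 2) 0

/-- The coordinatewise median of a multiset of points of the plane. -/
noncomputable def coordinatewiseMedian (P : Multiset Plane) : Plane :=
  !₂[lowerMedian (P.map fun p => p 0), lowerMedian (P.map fun p => p 1)]

/-- The Coordinatewise Median with Predictions mechanism with confidence `c`: the coordinatewise
median of the agents' points `P` together with `c n` copies of the prediction, `n = |P|`.
It is used only for instances where `c n` is an integer, so that `⌊c n⌋₊ = c n`. -/
noncomputable def cmpMechanism (c : ℝ) (P : Multiset Plane) (prediction : Plane) : Plane :=
  coordinatewiseMedian (P + Multiset.replicate ⌊c * (P.card : ℝ)⌋₊ prediction)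

/-- The instances to which the mechanism with confidence `c` applies: at least one agent, and
`c n` is an integer, where `n` is the number of agents. -/
def cmpMechanismInstances (c : ℝ) : Set (Multiset Plane) :=
  {P | P ≠ 0 ∧ ∃ k : ℤ, c * (P.card : ℝ) = (k : ℝ)}

/-- The mechanism `f`, which maps the agents' points and a prediction to a facility location, is
`α`-consistent on the class `I` of instances for the social cost `C`: it achieves an
`α`-approximation whenever the prediction is an optimal location. The ratio bound is
written without division, so that it also demands cost zero where the optimal cost is zero. -/
def IsConsistent (C : Plane → Multiset Plane → ℝ) (I : Set (Multiset Plane))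
    (f : Multiset Plane → Plane → Plane) (α : ℝ) : Prop :=
  ∀ P ∈ I, ∀ o : Plane, IsOptimalLocation C o P → C (f P o) P ≤ α * C o P

/-- The mechanism `f` is `β`-robust on the class `I` of instances for the social cost `C`: it
achieves a `β`-approximation whatever the prediction is. -/
def IsRobust (C : Plane → Multiset Plane → ℝ) (I : Set (Multiset Plane))
    (f : Multiset Plane → Plane → Plane) (β : ℝ) : Prop :=
  ∀ P ∈ I, ∀ prediction o : Plane, IsOptimalLocation C o P → C (f P prediction) P ≤ β * C o P

/-! Let `f` be the output. Call an agent opposite in a coordinate if `f` weakly separates it from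
`o` there. Each agent satisfies `d(f, p) ≤ l d(o, p) + A - B [opposite in x] - D [opposite in y]`
with `l² = 1 + m²` (`dist_le_of_le_one`, `dist_le_of_one_le`). Summing, the ratio `l` follows once
enough agents are opposite to cancel `n A`.

By the median property, at least `(1 + c) n / 2` of the agents and prediction copies are opposite in
each coordinate. A correct prediction is not opposite (unless it shares that coordinate with `f`),
so all of these are agents, and `m = (1 - c) / (1 + c)` makes the corrections cancel. An arbitrary
prediction may use up `c n` of them, leaving `(1 - c) n / 2` agents, for which `m = (1 + c) / (1 -
c)` is the right slope. -/

/-! ### Planar inequalities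

The coordinates below are taken relative to the facility, in absolute value: `(s, t)` is an agent's
location, at distance `r` from the facility, `(a, b)` is another location, and `e` is the distance
between the two. Moreover `l ^ 2 = 1 + m ^ 2`. -/

/-- Cauchy–Schwarz for the vectors `(m, 1)` and `(x, y)`. -/
lemma mul_add_le_mul_of_sq {l m x y e : ℝ} (hl : 0 ≤ l) (hlm : l ^ 2 = 1 + m ^ 2)
    (he : 0 ≤ e) (hes : e ^ 2 = x ^ 2 + y ^ 2) : m * x + y ≤ l * e := by
  refine (abs_le_of_sq_le_sq' ?_ (mul_nonneg hl he)).2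
  rw [mul_pow, hlm, hes]
  nlinarith [sq_nonneg (x - m * y)]

/-- Cauchy–Schwarz for `(s, t)`, whose norm is `r`, and `(x, y)`, whose norm is `e`. -/
lemma mul_add_mul_le_mul_of_sq {r e s t x y : ℝ} (hr : 0 ≤ r) (hrs : r ^ 2 = s ^ 2 + t ^ 2)
    (he : 0 ≤ e) (hes : e ^ 2 = x ^ 2 + y ^ 2) : s * x + t * y ≤ r * e := by
  refine (abs_le_of_sq_le_sq' ?_ (mul_nonneg hr he)).2
  rw [mul_pow, hrs, hes]
  nlinarith [sq_nonneg (s * y - t * x)]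

/-- The last hypothesis amounts to `s ≤ m * t`, so `2 * m * s * t ≥ 2 * s ^ 2` in the expanded
square. -/
lemma le_mul_add_of_le_mul {l m r s t : ℝ} (hm : 0 ≤ m) (hlm : l ^ 2 = 1 + m ^ 2) (hr : 0 ≤ r)
    (hs : 0 ≤ s) (ht : 0 ≤ t) (hrs : r ^ 2 = s ^ 2 + t ^ 2) (h : r ≤ l * t) : r ≤ m * s + t := by
  have h1 : r ^ 2 ≤ (l * t) ^ 2 := pow_le_pow_left₀ hr h 2
  have h2 : s ≤ m * t := by
    refine (abs_le_of_sq_le_sq' ?_ (mul_nonneg hm ht)).2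
    rw [mul_pow, hlm] at h1
    nlinarith
  refine (abs_le_of_sq_le_sq' ?_ (by positivity)).2
  nlinarith [mul_le_mul_of_nonneg_left h2 hs, sq_nonneg (m * s)]

lemma slope_mul_le_mul_of_mul_lt {l m r s t : ℝ} (hl : 0 ≤ l) (hlm : l ^ 2 = 1 + m ^ 2)
    (hs : 0 ≤ s) (hrs : r ^ 2 = s ^ 2 + t ^ 2) (h : l * t < r) (ht : 0 ≤ t) :
    m * r ≤ l * s := by
  have h1 : (l * t) ^ 2 ≤ r ^ 2 := pow_le_pow_left₀ (by positivity) h.le 2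
  refine (abs_le_of_sq_le_sq' ?_ (by positivity)).2
  rw [mul_pow, hlm] at h1
  rw [mul_pow, mul_pow, hlm]
  nlinarith

/-- The bound for an agent that lies on the other side of the facility than `(a, b)` with respect
to the first coordinate only. -/
lemma radius_add_mul_le_of_opposite_fst {l m r e s t a b : ℝ} (hl : 1 ≤ l) (hm : 0 ≤ m)
    (hlm : l ^ 2 = 1 + m ^ 2) (hr : 0 ≤ r) (he : 0 ≤ e) (hs : 0 ≤ s) (ht : 0 ≤ t) (ha : 0 ≤ a)
    (hb : 0 ≤ b) (hrs : r ^ 2 = s ^ 2 + t ^ 2) (hes : e ^ 2 = (s + a) ^ 2 + (t - b) ^ 2) :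
    r + m * a ≤ l * e + b := by
  have hl0 : 0 ≤ l := zero_le_one.trans hl
  -- Split by which side of the direction `(m, 1)` the vector `(s, t)` lies on: `e` is bounded below
  -- by projecting onto `(m, 1)` in the first case and onto `(s, t)` itself in the second.
  rcases le_or_gt r (l * t) with h | h
  · have h1 := le_mul_add_of_le_mul hm hlm hr hs ht hrs h
    have h2 := mul_add_le_mul_of_sq hl0 hlm he hes
    linarith
  · have hr0 : 0 < r := (mul_nonneg hl0 ht).trans_lt h
    have h1 := slope_mul_le_mul_of_mul_lt hl0 hlm hs hrs h ht
    have h2 := mul_le_mul_of_nonneg_left (mul_add_mul_le_mul_of_sq hr hrs he hes) hl0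
    refine le_of_mul_le_mul_left ?_ hr0
    nlinarith [mul_le_mul_of_nonneg_right h1 ha, mul_le_mul_of_nonneg_right h.le hb,
      mul_le_mul_of_nonneg_right hl (sq_nonneg r)]

/-- The bound for an agent that lies on the other side of the facility than `(a, b)` with respect
to both coordinates, when `m ≤ 1`. -/
lemma radius_add_mul_add_le_of_opposite {l m r e s t a b : ℝ} (hl : 1 ≤ l) (hm : 0 ≤ m)
    (hm1 : m ≤ 1) (hlm : l ^ 2 = 1 + m ^ 2) (hr : 0 ≤ r) (he : 0 ≤ e) (hs : 0 ≤ s) (ht : 0 ≤ t)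
    (ha : 0 ≤ a) (hb : 0 ≤ b) (hrs : r ^ 2 = s ^ 2 + t ^ 2)
    (hes : e ^ 2 = (s + a) ^ 2 + (t + b) ^ 2) : r + m * (a + b) ≤ l * e := by
  have hl0 : 0 ≤ l := zero_le_one.trans hl
  have hma : m * a ≤ a := mul_le_of_le_one_left ha hm1
  have hmb : m * b ≤ b := mul_le_of_le_one_left hb hm1
  rcases le_or_gt r (l * t) with h | h
  · have h1 := le_mul_add_of_le_mul hm hlm hr hs ht hrs h
    have h2 := mul_add_le_mul_of_sq hl0 hlm he hes
    linarith
  rcases le_or_gt r (l * s) with h' | h'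
  · have h1 := le_mul_add_of_le_mul hm hlm hr ht hs (by linarith) h'
    have h2 := mul_add_le_mul_of_sq hl0 hlm he (hes.trans (add_comm _ _))
    linarith
  · have hr0 : 0 < r := (mul_nonneg hl0 ht).trans_lt h
    have h1 := slope_mul_le_mul_of_mul_lt hl0 hlm hs hrs h ht
    have h1' := slope_mul_le_mul_of_mul_lt hl0 hlm ht (by linarith) h' hs
    have h2 := mul_le_mul_of_nonneg_left (mul_add_mul_le_mul_of_sq hr hrs he hes) hl0
    refine le_of_mul_le_mul_left ?_ hr0
    nlinarith [mul_le_mul_of_nonneg_right h1 ha, mul_le_mul_of_nonneg_right h1' hb,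
      mul_le_mul_of_nonneg_right hl (sq_nonneg r)]

/-- The bound for an agent that lies on the other side of the facility than `(a, b)` with respect
to both coordinates, in terms of the norm `R` of `(a, b)`. -/
lemma radius_add_mul_norm_le_of_opposite {l m r e R s t a b : ℝ} (hl : 0 ≤ l)
    (hlm : l ^ 2 = 1 + m ^ 2) (he : 0 ≤ e) (hs : 0 ≤ s) (ht : 0 ≤ t) (ha : 0 ≤ a) (hb : 0 ≤ b)
    (hrs : r ^ 2 = s ^ 2 + t ^ 2) (hR : R ^ 2 = a ^ 2 + b ^ 2)
    (hes : e ^ 2 = (s + a) ^ 2 + (t + b) ^ 2) : r + m * R ≤ l * e := by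
  refine (abs_le_of_sq_le_sq' ?_ (mul_nonneg hl he)).2
  have h1 : r ^ 2 + R ^ 2 ≤ e ^ 2 := by nlinarith [mul_nonneg hs ha, mul_nonneg ht hb]
  have h2 := mul_le_mul_of_nonneg_left h1 (sq_nonneg l)
  rw [mul_pow]
  refine le_trans ?_ h2
  rw [hlm]
  nlinarith [sq_nonneg (m * r - R)]

/-! ### Pointwise bounds in the plane -/

lemma Plane.dist_sq (p q : Plane) : dist p q ^ 2 = |p 0 - q 0| ^ 2 + |p 1 - q 1| ^ 2 := by
  rw [EuclideanSpace.dist_eq, Real.sq_sqrt (by positivity), Fin.sum_univ_two, Real.dist_eq,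
    Real.dist_eq]

lemma sq_abs_sub_of_mul_nonpos {x y z : ℝ} (h : (x - z) * (y - z) ≤ 0) :
    |x - y| ^ 2 = (|x - z| + |y - z|) ^ 2 := by
  have h1 : |x - z| * |y - z| = -((x - z) * (y - z)) := by rw [← abs_mul, abs_of_nonpos h]
  rw [add_sq, mul_assoc, h1, sq_abs, sq_abs, sq_abs]
  ring

lemma sq_abs_sub_of_mul_nonneg {x y z : ℝ} (h : 0 ≤ (x - z) * (y - z)) :
    |x - y| ^ 2 = (|x - z| - |y - z|) ^ 2 := by
  have h1 : |x - z| * |y - z| = (x - z) * (y - z) := by rw [← abs_mul, abs_of_nonneg h]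
  rw [sub_sq, mul_assoc, h1, sq_abs, sq_abs, sq_abs]
  ring

/-- Here `A` is the ℓ¹ distance from `o` to `f`, so the budget splits by coordinate. -/
lemma dist_le_of_le_one {l m : ℝ} (hl : 1 ≤ l) (hm : 0 ≤ m) (hm1 : m ≤ 1)
    (hlm : l ^ 2 = 1 + m ^ 2) (f o p : Plane) :
    dist f p ≤ l * dist o p + ((|o 0 - f 0| + |o 1 - f 1|)
      - (if (p 0 - f 0) * (o 0 - f 0) ≤ 0 then (1 + m) * |o 0 - f 0| else 0)
      - (if (p 1 - f 1) * (o 1 - f 1) ≤ 0 then (1 + m) * |o 1 - f 1| else 0)) := by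
  have hrs := Plane.dist_sq p f
  have hes := Plane.dist_sq p o
  have hR := Plane.dist_sq o f
  rw [dist_comm f p, dist_comm o p]
  have hs := abs_nonneg (p 0 - f 0)
  have ht := abs_nonneg (p 1 - f 1)
  have ha := abs_nonneg (o 0 - f 0)
  have hb := abs_nonneg (o 1 - f 1)
  split_ifs with h0 h1 h1
  · rw [sq_abs_sub_of_mul_nonpos h0, sq_abs_sub_of_mul_nonpos h1] at hes
    have := radius_add_mul_add_le_of_opposite hl hm hm1 hlm dist_nonneg dist_nonneg hs ht ha hb
      hrs hes
    linarith
  · rw [sq_abs_sub_of_mul_nonpos h0, sq_abs_sub_of_mul_nonneg (not_le.1 h1).le] at hes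
    have := radius_add_mul_le_of_opposite_fst hl hm hlm dist_nonneg dist_nonneg hs ht ha hb
      hrs hes
    linarith
  · rw [sq_abs_sub_of_mul_nonneg (not_le.1 h0).le, sq_abs_sub_of_mul_nonpos h1] at hes
    have := radius_add_mul_le_of_opposite_fst hl hm hlm dist_nonneg dist_nonneg ht hs hb ha
      (hrs.trans (add_comm _ _)) (hes.trans (add_comm _ _))
    linarith
  · have h2 := dist_triangle p o f
    have h3 : dist p o ≤ l * dist p o := le_mul_of_one_le_left dist_nonneg hl
    have h4 : dist o f ≤ |o 0 - f 0| + |o 1 - f 1| :=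
      (abs_le_of_sq_le_sq' (by nlinarith [mul_nonneg ha hb]) (by positivity)).2
    linarith

/-- For `m > 1` the ℓ¹ budget is replaced by `A = dist o f`. The asymmetric weights sum to `(1 + m)
* A`; they make the bound tight to the planar inequality when only the first coordinate or both are
opposite, and the remaining mixed case has slack. -/
lemma dist_le_of_one_le {l m : ℝ} (hl : 1 ≤ l) (hm1 : 1 ≤ m)
    (hlm : l ^ 2 = 1 + m ^ 2) (f o p : Plane) :
    dist f p ≤ l * dist o p + (dist o f
      - (if (p 0 - f 0) * (o 0 - f 0) ≤ 0 then dist o f - |o 1 - f 1| + m * |o 0 - f 0| else 0)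
      - (if (p 1 - f 1) * (o 1 - f 1) ≤ 0 then
          m * dist o f + |o 1 - f 1| - m * |o 0 - f 0| else 0)) := by
  have hm : 0 ≤ m := zero_le_one.trans hm1
  have hrs := Plane.dist_sq p f
  have hes := Plane.dist_sq p o
  have hR := Plane.dist_sq o f
  rw [dist_comm f p, dist_comm o p]
  have hs := abs_nonneg (p 0 - f 0)
  have ht := abs_nonneg (p 1 - f 1)
  have ha := abs_nonneg (o 0 - f 0)
  have hb := abs_nonneg (o 1 - f 1)
  split_ifs with h0 h1 h1
  · rw [sq_abs_sub_of_mul_nonpos h0, sq_abs_sub_of_mul_nonpos h1] at hes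
    have := radius_add_mul_norm_le_of_opposite (zero_le_one.trans hl) hlm dist_nonneg hs ht ha hb
      hrs hR hes
    linarith
  · rw [sq_abs_sub_of_mul_nonpos h0, sq_abs_sub_of_mul_nonneg (not_le.1 h1).le] at hes
    have := radius_add_mul_le_of_opposite_fst hl hm hlm dist_nonneg dist_nonneg hs ht ha hb
      hrs hes
    linarith
  · rw [sq_abs_sub_of_mul_nonneg (not_le.1 h0).le, sq_abs_sub_of_mul_nonpos h1] at hes
    have h2 := radius_add_mul_le_of_opposite_fst hl hm hlm dist_nonneg dist_nonneg ht hs hb ha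
      (hrs.trans (add_comm _ _)) (hes.trans (add_comm _ _))
    have h4 : dist o f ≤ |o 0 - f 0| + |o 1 - f 1| :=
      (abs_le_of_sq_le_sq' (by nlinarith [mul_nonneg ha hb]) (by positivity)).2
    have h5 := mul_nonneg (sub_nonneg.2 hm1) (sub_nonneg.2 h4)
    linarith
  · have h2 := dist_triangle p o f
    have h3 : dist p o ≤ l * dist p o := le_mul_of_one_le_left dist_nonneg hl
    linarith

/-! ### The lower median -/

lemma le_countP_of_forall_lt {α : Type*} (q : α → Bool) (l : List α) (k : ℕ) (hk : k ≤ l.length)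
    (h : ∀ i (hi : i < l.length), i < k → q l[i] = true) : k ≤ l.countP q := by
  have h1 : (l.take k).countP q = (l.take k).length := by
    rw [List.countP_eq_length]
    intro a ha
    obtain ⟨i, hi, rfl⟩ := List.mem_iff_getElem.1 ha
    rw [List.getElem_take]
    exact h i _ (by simp at hi; omega)
  calc k = (l.take k).countP q := by rw [h1, List.length_take]; omega
    _ ≤ l.countP q := (List.take_sublist k l).countP_le

lemma length_sub_le_countP_of_forall_le {α : Type*} (q : α → Bool) (l : List α) (k : ℕ)
    (h : ∀ i (hi : i < l.length), k ≤ i → q l[i] = true) : l.length - k ≤ l.countP q := by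
  have h1 : (l.drop k).countP q = (l.drop k).length := by
    rw [List.countP_eq_length]
    intro a ha
    obtain ⟨i, hi, rfl⟩ := List.mem_iff_getElem.1 ha
    rw [List.getElem_drop]
    exact h _ _ (by omega)
  calc l.length - k = (l.drop k).countP q := by rw [h1, List.length_drop]
    _ ≤ l.countP q := (List.drop_sublist k l).countP_le

lemma countP_sort (q : ℝ → Prop) [DecidablePred q] (s : Multiset ℝ) :
    (s.sort (· ≤ ·)).countP (fun x => decide (q x)) = s.countP q := by
  conv_rhs => rw [← s.sort_eq (· ≤ ·), Multiset.coe_countP]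

/-- The sorted entries up to and including the median's index qualify: exactly half when the
cardinality is even and positive. -/
lemma card_le_two_mul_countP_le_lowerMedian (s : Multiset ℝ) :
    s.card ≤ 2 * s.countP (fun x => x ≤ lowerMedian s) := by
  rcases Nat.eq_zero_or_pos s.card with h0 | h0
  · omega
  have hlen : (s.sort (· ≤ ·)).length = s.card := Multiset.length_sort _
  have hk : (s.card - 1) / 2 < (s.sort (· ≤ ·)).length := by omega
  have hsort : (s.sort (· ≤ ·)).Pairwise (· ≤ ·) := s.pairwise_sort (· ≤ ·)
  have h := le_countP_of_forall_lt (fun x => decide (x ≤ lowerMedian s)) (s.sort (· ≤ ·))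
    ((s.card - 1) / 2 + 1) (by omega) (by
      intro i hi hik
      rw [decide_eq_true_eq, lowerMedian, List.getD_eq_getElem _ _ hk]
      exact hsort.sortedLE.getElem_le_getElem_of_le (by omega))
  rw [countP_sort] at h
  omega

lemma card_le_two_mul_countP_lowerMedian_le (s : Multiset ℝ) :
    s.card ≤ 2 * s.countP (fun x => lowerMedian s ≤ x) := by
  rcases Nat.eq_zero_or_pos s.card with h0 | h0
  · omega
  have hlen : (s.sort (· ≤ ·)).length = s.card := Multiset.length_sort _
  have hk : (s.card - 1) / 2 < (s.sort (· ≤ ·)).length := by omega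
  have hsort : (s.sort (· ≤ ·)).Pairwise (· ≤ ·) := s.pairwise_sort (· ≤ ·)
  have h := length_sub_le_countP_of_forall_le (fun x => decide (lowerMedian s ≤ x)) (s.sort (· ≤ ·))
    ((s.card - 1) / 2) (by
      intro i hi hik
      rw [decide_eq_true_eq, lowerMedian, List.getD_eq_getElem _ _ hk]
      exact hsort.sortedLE.getElem_le_getElem_of_le hik)
  rw [countP_sort (fun x => lowerMedian s ≤ x)] at h
  omega

/-- At least half of the elements lie on the other side of the median than a given point `y`. -/
lemma card_le_two_mul_countP_opposite (s : Multiset ℝ) (y : ℝ) :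
    s.card ≤ 2 * s.countP (fun x => (x - lowerMedian s) * (y - lowerMedian s) ≤ 0) := by
  rcases le_total y (lowerMedian s) with h | h
  · refine (card_le_two_mul_countP_lowerMedian_le s).trans (Nat.mul_le_mul_left 2 ?_)
    rw [Multiset.countP_eq_card_filter, Multiset.countP_eq_card_filter]
    exact Multiset.card_le_card (Multiset.monotone_filter_right s fun x hx =>
      mul_nonpos_of_nonneg_of_nonpos (sub_nonneg.2 hx) (sub_nonpos.2 h))
  · refine (card_le_two_mul_countP_le_lowerMedian s).trans (Nat.mul_le_mul_left 2 ?_)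
    rw [Multiset.countP_eq_card_filter, Multiset.countP_eq_card_filter]
    exact Multiset.card_le_card (Multiset.monotone_filter_right s fun x hx =>
      mul_nonpos_of_nonpos_of_nonneg (sub_nonpos.2 hx) (sub_nonneg.2 h))

/-! ### The mechanism -/

lemma coordinatewiseMedian_apply (P : Multiset Plane) (i : Fin 2) :
    coordinatewiseMedian P i = lowerMedian (P.map fun p => p i) := by
  fin_cases i <;> simp [coordinatewiseMedian]

lemma card_add_le_two_mul_countP_opposite (P : Multiset Plane) (k : ℕ) (q o : Plane) (i : Fin 2)
    {f : Plane} (hf : f = coordinatewiseMedian (P + Multiset.replicate k q)) :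
    P.card + k ≤ 2 * (P.countP (fun p => (p i - f i) * (o i - f i) ≤ 0)
      + if (q i - f i) * (o i - f i) ≤ 0 then k else 0) := by
  have h := card_le_two_mul_countP_opposite ((P + Multiset.replicate k q).map fun p => p i) (o i)
  rw [← coordinatewiseMedian_apply, ← hf, Multiset.card_map, Multiset.card_add,
    Multiset.card_replicate, Multiset.countP_map, ← Multiset.countP_eq_card_filter,
    Multiset.countP_add] at h
  convert h using 3
  split_ifs with hq
  · exact (Multiset.card_replicate k q).symm.trans
      (Multiset.countP_eq_card.2 fun a ha => by rwa [Multiset.eq_of_mem_replicate ha]).symm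
  · exact (Multiset.countP_eq_zero.2 fun a ha => by
      rwa [Multiset.eq_of_mem_replicate ha]).symm

lemma sum_dist_le_of_forall {l A B D : ℝ} {f o : Plane} {X Y : Plane → Prop} [DecidablePred X]
    [DecidablePred Y] (h : ∀ p, dist f p ≤ l * dist o p
      + (A - (if X p then B else 0) - (if Y p then D else 0))) (P : Multiset Plane) :
    (P.map fun p => dist f p).sum ≤ l * (P.map fun p => dist o p).sum
      + (P.card * A - P.countP X * B - P.countP Y * D) := by
  induction P using Multiset.induction_on with
  | empty => simp
  | cons p P ih =>
    have hp := h p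
    simp only [Multiset.map_cons, Multiset.sum_cons, Multiset.card_cons, Multiset.countP_cons]
    split_ifs at hp ⊢ <;> push_cast <;> linarith

lemma utilitarianCost_le_of_forall {l A B D : ℝ} {f o : Plane} {X Y : Plane → Prop}
    [DecidablePred X] [DecidablePred Y] (h : ∀ p, dist f p ≤ l * dist o p
      + (A - (if X p then B else 0) - (if Y p then D else 0))) (P : Multiset Plane)
    (hP : P.card * A ≤ P.countP X * B + P.countP Y * D) :
    utilitarianCost f P ≤ l * utilitarianCost o P := by
  unfold utilitarianCost
  rw [← mul_div_assoc]
  have := sum_dist_le_of_forall h P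
  gcongr
  linarith

/-- The relation between the approximation ratio `√(2 c² + 2) / (1 + c)` and the slope
`(1 - c) / (1 + c)`. -/
lemma sq_sqrt_div_one_add {c : ℝ} (hc : -1 < c) :
    (√(2 * c ^ 2 + 2) / (1 + c)) ^ 2 = 1 + ((1 - c) / (1 + c)) ^ 2 := by
  have : 1 + c ≠ 0 := by linarith
  rw [div_pow, Real.sq_sqrt (by positivity)]
  field_simp
  ring

lemma one_le_sqrt_div_one_add {c : ℝ} (hc : -1 < c) : 1 ≤ √(2 * c ^ 2 + 2) / (1 + c) := by
  rw [one_le_div (by linarith)]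
  exact Real.le_sqrt_of_sq_le (by nlinarith [sq_nonneg (1 - c)])

lemma natFloor_eq_of_mem_cmpMechanismInstances {c : ℝ} (hc : 0 ≤ c) {P : Multiset Plane}
    (hP : P ∈ cmpMechanismInstances c) : (⌊c * (P.card : ℝ)⌋₊ : ℝ) = c * P.card := by
  obtain ⟨-, k, hk⟩ := hP
  have hk0 : 0 ≤ k := by
    have : (0 : ℝ) ≤ k := hk ▸ by positivity
    exact_mod_cast this
  lift k to ℕ using hk0
  rw [hk, Int.cast_natCast, Nat.floor_natCast]

theorem isConsistent_cmpMechanism {c : ℝ} (hc₀ : 0 ≤ c) (hc₁ : c < 1) :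
    IsConsistent utilitarianCost (cmpMechanismInstances c) (cmpMechanism c)
      (√(2 * c ^ 2 + 2) / (1 + c)) := by
  intro P hP o _
  have hk := natFloor_eq_of_mem_cmpMechanismInstances hc₀ hP
  obtain ⟨f, hf⟩ : ∃ f, f = cmpMechanism c P o := ⟨_, rfl⟩
  rw [← hf]
  have hc : -1 < c := by linarith
  have hc1 : 0 < 1 + c := by linarith
  have hcoord (i : Fin 2) : P.card * |o i - f i| ≤
      P.countP (fun p => (p i - f i) * (o i - f i) ≤ 0)
        * ((1 + (1 - c) / (1 + c)) * |o i - f i|) := by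
    -- If `o` and `f` agree in this coordinate, the prediction counts as opposite, but the weight
    -- vanishes.
    rcases eq_or_ne (o i - f i) 0 with h0 | h0
    · simp [h0]
    have h := card_add_le_two_mul_countP_opposite P _ o o i hf
    rw [if_neg (not_le.2 (mul_self_pos.2 h0)), add_zero] at h
    have h' : (P.card : ℝ) + c * P.card ≤
        2 * P.countP (fun p => (p i - f i) * (o i - f i) ≤ 0) := by
      rw [← hk]; exact_mod_cast h
    rw [← mul_assoc]
    refine mul_le_mul_of_nonneg_right ?_ (abs_nonneg _)
    have : 1 + (1 - c) / (1 + c) = 2 / (1 + c) := by field_simp; ring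
    rw [this, ← mul_div_assoc, le_div_iff₀ hc1]
    linarith
  refine utilitarianCost_le_of_forall (dist_le_of_le_one (one_le_sqrt_div_one_add hc)
    (div_nonneg (by linarith) hc1.le) ((div_le_one hc1).2 (by linarith))
    (sq_sqrt_div_one_add hc) f o) P ?_
  linarith [hcoord 0, hcoord 1]

theorem isRobust_cmpMechanism {c : ℝ} (hc₀ : 0 ≤ c) (hc₁ : c < 1) :
    IsRobust utilitarianCost (cmpMechanismInstances c) (cmpMechanism c)
      (√(2 * c ^ 2 + 2) / (1 - c)) := by
  intro P hP q o _
  have hk := natFloor_eq_of_mem_cmpMechanismInstances hc₀ hP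
  obtain ⟨f, hf⟩ : ∃ f, f = cmpMechanism c P q := ⟨_, rfl⟩
  rw [← hf]
  -- The robustness ratio and slope are those of consistency with `-c` in place of `c`.
  have hc : -1 < -c := by linarith
  have hc1 : 0 < 1 - c := by linarith
  have hl := one_le_sqrt_div_one_add hc
  have hlm := sq_sqrt_div_one_add hc
  rw [neg_sq, ← sub_eq_add_neg] at hl hlm
  rw [sub_neg_eq_add] at hlm
  have hm1 : 1 ≤ (1 + c) / (1 - c) := (one_le_div hc1).2 (by linarith)
  have hcoord (i : Fin 2) : P.card * (1 - c) / 2 ≤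
      (P.countP (fun p => (p i - f i) * (o i - f i) ≤ 0) : ℝ) := by
    have h := card_add_le_two_mul_countP_opposite P _ q o i hf
    have h1 : P.card ≤ 2 * P.countP (fun p => (p i - f i) * (o i - f i) ≤ 0)
        + ⌊c * (P.card : ℝ)⌋₊ := by
      split_ifs at h <;> omega
    have h' : (P.card : ℝ) ≤
        2 * P.countP (fun p => (p i - f i) * (o i - f i) ≤ 0) + c * P.card := by
      rw [← hk]; exact_mod_cast h1
    linarith
  have hR := Plane.dist_sq o f
  have ha : |o 0 - f 0| ≤ dist o f := (abs_le_of_sq_le_sq' (by nlinarith) dist_nonneg).2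
  have hb : |o 1 - f 1| ≤ dist o f := (abs_le_of_sq_le_sq' (by nlinarith) dist_nonneg).2
  refine utilitarianCost_le_of_forall (dist_le_of_one_le hl hm1 hlm f o) P ?_
  have hm0 := zero_le_one.trans hm1
  -- Both weights are nonnegative, being `(R - b) + m * a` and `m * (R - a) + b` with `R = dist o
  -- f`, `a = |o 0 - f 0|`, `b = |o 1 - f 1|`.
  have h0 := mul_le_mul_of_nonneg_right (hcoord 0)
    (add_nonneg (sub_nonneg.2 hb) (mul_nonneg hm0 (abs_nonneg (o 0 - f 0))))
  have h1 := mul_le_mul_of_nonneg_right (hcoord 1)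
    (add_nonneg (mul_nonneg hm0 (sub_nonneg.2 ha)) (abs_nonneg (o 1 - f 1)))
  have h2 : P.card * (1 - c) / 2 * ((1 + (1 + c) / (1 - c)) * dist o f) = P.card * dist o f := by
    field_simp
    ring
  linarith

theorem mainTheorem1 (c : ℝ) (hc₀ : 0 ≤ c) (hc₁ : c < 1) :
    IsConsistent utilitarianCost (cmpMechanismInstances c) (cmpMechanism c) (√(2 * c ^ 2 + 2) / (1 + c)) ∧
      IsRobust utilitarianCost (cmpMechanismInstances c) (cmpMechanism c) (√(2 * c ^ 2 + 2) / (1 - c)) :=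
  ⟨isConsistent_cmpMechanism hc₀ hc₁, isRobust_cmpMechanism hc₀ hc₁⟩
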